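/- A metric space is proper if all its closed balls are compact. Let $X$ be a metric space with base point $x_0$ (nothing below depends on its choice), let $B_r(x)$ be the open ball of radius $r$ about $x$, and let distances to the empty set be $\infty$. Subsets $A,B\subset X$ are asymptotically disjoint if $\lim_{r\to\infty} d(A\setminus B_r(x_0),B\setminus B_r(x_0))=\infty$. A map $\varphi:X\to[0,1]$ is slowly oscillating if for all $r,\varepsilon>0$ there is $D>0$ with $\operatorname{diam}\varphi(B_r(x))<\varepsilon$ whenever $d(x,x_0)\ge D$. Let $C_h(X)$ be the set of continuous slowly oscillating maps $X\to[0,1]$. The Higson compactification $cX$ is the closure of the image of $X$ under $x\mapsto(\varphi(x))_{\varphi\in C_h(X)}\in[0,1]^{C_h(X)}$. The Higson corona $\nu X$ is the set of points of $cX$ that lie in the closure of (the image of) no bounded subset of $X$; if $X$ is proper, then $\nu X=cX\setminus X$. The trace of $A\subset X$ is $A'=\operatorname{cl}_{cX}A\cap\nu X$. A closed set $C\subset X$ is an asymptotic separator for $A$ and $B$ if $C'$ is a partition between $A'$ and $B'$ in $\nu X$, that is, $\nu X\setminus C'=U_1\cup U_2$ with $U_1,U_2$ disjoint and open in $\nu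 X$, $A'\subset U_1$ and $B'\subset U_2$. The asymptotic large inductive dimension $\operatorname{asInd}X\in\{-1,0,1,\dots\}\cup\{\infty\}$ is defined as follows: $\operatorname{asInd}X=-1$ if and only if $X$ is bounded; for $n\ge 0$, $\operatorname{asInd}X\le n$ if any two asymptotically disjoint subsets $A,B\subset X$ have an asymptotic separator $C$ with $\operatorname{asInd}C\le n-1$ (where $C$ carries the restricted metric); and $\operatorname{asInd}X=\infty$ if $\operatorname{asInd}X\le n$ holds for no $n$. **Theorem (subspace theorem).** Let $X$ be a proper metric space and let $Y\subset X$ be any subset, with the restricted metric. Then $\operatorname{asInd}Y\le\operatorname{asInd}X$. -/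

import Mathlib

namespace AsymptoticDimension

universe u

section Partition

/-- `C` is a partition between `A₁` and `A₂` in the topological space `T`: the complement of `C`
is a union of two disjoint open sets, one containing `A₁` and the other containing `A₂`. -/
def IsPartition {T : Type*} [TopologicalSpace T] (C A₁ A₂ : Set T) : Prop :=
  ∃ U₁ U₂ : Set T, IsOpen U₁ ∧ IsOpen U₂ ∧ Disjoint U₁ U₂ ∧ Cᶜ = U₁ ∪ U₂ ∧ A₁ ⊆ U₁ ∧ A₂ ⊆ U₂

end Partition

section Metric

variable {X : Type u} [MetricSpace X]

/-- `A₁` and `A₂` are asymptotically disjoint: `d(A₁ \ B_r(x₀), A₂ \ B_r(x₀)) → ∞` as `r → ∞`,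
where the distance to the empty set is infinite. The condition does not depend on the base point
`x₀`, so it is required for all of them; this also makes sense of it in the empty space. -/
def AsymptoticallyDisjoint (A₁ A₂ : Set X) : Prop :=
  ∀ x₀ : X, ∀ R : ℝ, ∃ r₀ : ℝ, ∀ r ≥ r₀,
    ∀ a ∈ A₁ \ Metric.ball x₀ r, ∀ b ∈ A₂ \ Metric.ball x₀ r, R ≤ dist a b

/-- A map `φ : X → [0,1]` is slowly oscillating: for all `r, ε > 0` there is `D > 0` such that
`diam φ(B_r(x)) < ε` whenever `d(x, x₀) ≥ D`. Again the base point does not matter. -/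
def SlowlyOscillating (φ : X → unitInterval) : Prop :=
  ∀ x₀ : X, ∀ r : ℝ, 0 < r → ∀ ε : ℝ, 0 < ε → ∃ D : ℝ, 0 < D ∧ ∀ x : X, D ≤ dist x x₀ →
    Metric.diam (φ '' Metric.ball x r) < ε

variable (X) in
/-- The set `C_h(X)` of continuous slowly oscillating functions `X → [0,1]`. -/
def HigsonFunction : Type u :=
  {φ : C(X, unitInterval) // SlowlyOscillating φ}

/-- The map `Φ : X → [0,1]^{C_h(X)}`, `Φ(x) = (φ(x))_φ`. -/
def higsonMap (x : X) : HigsonFunction X → unitInterval :=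
  fun φ => φ.1 x

variable (X) in
/-- The Higson compactification `cX`: the closure of `Φ(X)` in `[0,1]^{C_h(X)}`. -/
def higsonCompactification : Set (HigsonFunction X → unitInterval) :=
  closure (Set.range (higsonMap (X := X)))

variable (X) in
/-- The Higson corona `νX`: the points of `cX` at infinity, that is, the points that lie in the
closure of no bounded subset of `X`. For a proper space `X` this is the remainder `cX \ X`, see
`higsonCorona_eq_remainder`; the present form is also meaningful for a subspace of a proper space
that is not closed (where `cX \ X` would contain points at a finite distance). -/
def higsonCorona : Set (HigsonFunction X → unitInterval) :=
  {p | p ∈ higsonCompactification X ∧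
    ∀ B : Set X, Bornology.IsBounded B → p ∉ closure (higsonMap '' B)}

variable (X) in
theorem continuous_higsonMap : Continuous (higsonMap (X := X)) :=
  continuous_pi fun φ => φ.1.continuous

variable (X) in
/-- In a proper metric space the Higson corona is the remainder `cX \ X`. -/
theorem higsonCorona_eq_remainder [ProperSpace X] :
    higsonCorona X = higsonCompactification X \ Set.range (higsonMap (X := X)) := by
  ext p
  constructor
  · rintro ⟨hp, hB⟩
    refine ⟨hp, ?_⟩
    rintro ⟨x, rfl⟩
    exact hB {x} Bornology.isBounded_singleton (subset_closure ⟨x, rfl, rfl⟩)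
  · rintro ⟨hp, hx⟩
    refine ⟨hp, fun B hB hpB => hx ?_⟩
    have hcl : IsClosed (higsonMap '' closure B) :=
      (hB.isCompact_closure.image (continuous_higsonMap X)).isClosed
    obtain ⟨x, -, rfl⟩ := closure_minimal (Set.image_mono subset_closure) hcl hpB
    exact ⟨x, rfl⟩

/-- The trace `A' = cl A ∩ νX` of a subset `A` of `X` in the Higson corona, as a subset of the
topological space `νX`. -/
def trace (A : Set X) : Set (higsonCorona X) :=
  {p | p.1 ∈ closure (higsonMap '' A)}

/-- A closed subset `C` of `X` is an asymptotic separator for `A` and `B` if its trace is a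
partition between the traces of `A` and `B` in the Higson corona. -/
def IsAsymptoticSeparator (C A B : Set X) : Prop :=
  IsClosed C ∧ IsPartition (trace C) (trace A) (trace B)

end Metric

/-- `AsIndLT n X` says that `asInd X ≤ n - 1`: for `n = 0` (that is, `asInd X ≤ -1`) the space is
bounded, and `asInd X ≤ n` means that any two asymptotically disjoint subsets of `X` have an
asymptotic separator `C` with `asInd C ≤ n - 1`, where `C` carries the restricted metric. -/
def AsIndLT : ℕ → ∀ (X : Type u) [MetricSpace X], Prop
  | 0, X, _ => Bornology.IsBounded (Set.univ : Set X)
  | n + 1, X, _ => ∀ A B : Set X, AsymptoticallyDisjoint A B →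
      ∃ C : Set X, IsAsymptoticSeparator C A B ∧ AsIndLT n C

theorem AsIndLT.succ : ∀ (n : ℕ) (X : Type u) [MetricSpace X], AsIndLT n X → AsIndLT (n + 1) X
  | 0, X, _, h => by
    intro A B _
    have : IsEmpty (higsonCorona X) := ⟨fun p => p.2.2 Set.univ h (by
      rw [Set.image_univ]; exact p.2.1)⟩
    refine ⟨∅, ⟨isClosed_empty, ∅, ∅, isOpen_empty, isOpen_empty, disjoint_bot_left, ?_, ?_, ?_⟩, ?_⟩
    · exact Subsingleton.elim _ _
    · exact (Subsingleton.elim _ _ : trace A = ∅).subset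
    · exact (Subsingleton.elim _ _ : trace B = ∅).subset
    · exact (Set.finite_univ (α := (∅ : Set X))).isBounded
  | n + 1, X, _, h => by
    intro A B hAB
    obtain ⟨C, hC, hn⟩ := h A B hAB
    exact ⟨C, hC, AsIndLT.succ n C hn⟩

open Classical in
/-- The asymptotic large inductive dimension, with values in `{-1, 0, 1, …} ∪ {∞}`: the least
`n ≥ -1` with `asInd X ≤ n`, and `∞` if there is none. -/
noncomputable def asInd (X : Type u) [MetricSpace X] : WithTop ℤ :=
  if h : ∃ n : ℕ, AsIndLT n X then (((Nat.find h : ℤ) - 1 : ℤ) : WithTop ℤ) else ⊤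

/-- The relation `asInd X ≤ n - 1` for the value `asInd X` is the recursively defined one. -/
theorem asInd_le_iff (X : Type u) [MetricSpace X] (n : ℕ) :
    asInd X ≤ (((n : ℤ) - 1 : ℤ) : WithTop ℤ) ↔ AsIndLT n X := by
  classical
  unfold asInd
  split_ifs with h
  · rw [WithTop.coe_le_coe, sub_le_sub_iff_right, Nat.cast_le]
    refine ⟨fun hn => ?_, fun hn => Nat.find_min' h hn⟩
    exact Nat.le_induction (Nat.find_spec h) (fun k _ hk => AsIndLT.succ k X hk) n hn
  · exact ⟨fun hn => absurd hn (by simp), fun hn => absurd ⟨n, hn⟩ h⟩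

end AsymptoticDimension

/-! The inclusion of a subspace is bi-Lipschitz, and the induction runs over all bi-Lipschitz
embeddings `f : Y → X`, because the separators built in `Y` map to those of `X` rather than lie in
them. If `C` separates `f '' A` and `f '' B`, a separator `T` in `Y` must asymptotically catch every
subset of `Y` that stays at some bounded distance from `C`. No single neighbourhood of `C` suffices
for all bounds at once, and the union of all of them is too large to embed in `C`.

The remedy is to thin out: points of `Y` about `k` away from `C` are kept only at mutual distance at
least `4 * (k + 1)` (`exists_sparse_net`). Moving each kept point into `C` then changes distances by
at most a factor two, so `T` embeds in `C` and induction applies. Thinning costs nothing in the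
corona, since at each fixed distance from `C` the net is still dense on a bounded scale. The passage
between metric and corona is `asymptoticallyDisjoint_iff_disjoint_trace`. -/

namespace AsymptoticDimension

universe u

/-! ### Greedy nets of variable scale -/

section GreedyNet

/-- A subset of `S` that is sparse at each point on the scale prescribed by the level of the point,
and dense in `S` on the same scale: it is chosen greedily, points of low level first. -/
theorem exists_sparse_net {α : Type*} (d : α → α → ℝ) (hd : ∀ x y, d x y = d y x)
    (ℓ : α → ℕ) (m : ℕ → ℝ) (S : Set α) :
    ∃ T ⊆ S, (∀ x ∈ T, ∀ y ∈ T, x ≠ y → m (max (ℓ x) (ℓ y)) ≤ d x y) ∧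
      ∀ z ∈ S, ∃ t ∈ T, t = z ∨ d z t < m (ℓ z) := by
  classical
  -- Level first, then an arbitrary well-order to break ties. A rejected point is thus blocked at
  -- its own scale `m (ℓ x)`, even by a point of lower level.
  let r : α → α → Prop := InvImage (Prod.Lex (· < ·) WellOrderingRel) fun x => (ℓ x, x)
  have hr : WellFounded r :=
    InvImage.wf _ (WellFounded.prod_lex wellFounded_lt WellOrderingRel.isWellOrder.wf)
  let P : α → Prop := hr.fix fun x ih => x ∈ S ∧ ∀ y (h : r y x), ih y h → m (ℓ x) ≤ d x y
  have hP : ∀ x, P x ↔ x ∈ S ∧ ∀ y, r y x → P y → m (ℓ x) ≤ d x y := fun x => by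
    simp only [P]
    rw [hr.fix_eq]
  have hle : ∀ x y, r x y → ℓ x ≤ ℓ y := fun x y h => by
    rcases Prod.lex_def.1 h with h | h
    · exact h.le
    · exact h.1.le
  have htri : ∀ x y, x ≠ y → r x y ∨ r y x := fun x y hxy => by
    rcases lt_trichotomy (ℓ x) (ℓ y) with h | h | h
    · exact Or.inl (Prod.lex_def.2 (Or.inl h))
    · rcases trichotomous_of WellOrderingRel x y with h' | h' | h'
      · exact Or.inl (Prod.lex_def.2 (Or.inr ⟨h, h'⟩))
      · exact absurd h' hxy
      · exact Or.inr (Prod.lex_def.2 (Or.inr ⟨h.symm, h'⟩))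
    · exact Or.inr (Prod.lex_def.2 (Or.inl h))
  refine ⟨{x | P x}, fun x hx => ((hP x).1 hx).1, fun x hx y hy hxy => ?_, fun z hz => ?_⟩
  · rcases htri x y hxy with h | h
    · rw [max_eq_right (hle x y h), hd]
      exact ((hP y).1 hy).2 x h hx
    · rw [max_eq_left (hle y x h)]
      exact ((hP x).1 hx).2 y h hy
  · by_cases h : P z
    · exact ⟨z, h, Or.inl rfl⟩
    · rw [hP] at h
      push Not at h
      obtain ⟨y, -, hy, hlt⟩ := h hz
      exact ⟨y, hy, Or.inr hlt⟩

end GreedyNet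

/-! ### Asymptotic disjointness and traces in the corona -/

section HigsonCorona

variable {X : Type u} [MetricSpace X]

theorem asymptoticallyDisjoint_iff {A B : Set X} :
    AsymptoticallyDisjoint A B ↔
      ∀ R : ℝ, Bornology.IsBounded {a | a ∈ A ∧ ∃ b ∈ B, dist a b ≤ R} := by
  constructor
  · intro h R
    rcases isEmpty_or_nonempty X with hX | ⟨⟨x₀⟩⟩
    · exact (Set.toFinite _).isBounded
    obtain ⟨r, hr⟩ := h x₀ (R + 1)
    refine (Metric.isBounded_ball (x := x₀) (r := r + |R|)).subset ?_
    rintro a ⟨ha, b, hb, hab⟩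
    rw [Metric.mem_ball]
    by_contra! hlt
    have h1 : a ∉ Metric.ball x₀ r := by
      rw [Metric.mem_ball, not_lt]
      linarith [abs_nonneg R]
    have h2 : b ∉ Metric.ball x₀ r := by
      rw [Metric.mem_ball, not_lt]
      linarith [dist_triangle a b x₀, le_abs_self R]
    linarith [hr r le_rfl a ⟨ha, h1⟩ b ⟨hb, h2⟩]
  · intro h x₀ R
    obtain ⟨r, hr⟩ := (h R).subset_ball x₀
    refine ⟨r, fun s hs a ha b hb => ?_⟩
    by_contra! hlt
    exact ha.2 (Metric.ball_subset_ball hs (hr ⟨ha.1, b, hb.1, hlt.le⟩))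

theorem slowlyOscillating_iff {φ : X → unitInterval} :
    SlowlyOscillating φ ↔ ∀ r ε : ℝ, 0 < ε →
      ∃ S : Set X, Bornology.IsBounded S ∧ ∀ x ∉ S, ∀ y, dist x y < r →
        dist (φ x) (φ y) < ε := by
  constructor
  · intro h r ε hε
    rcases isEmpty_or_nonempty X with hX | ⟨⟨x₀⟩⟩
    · exact ⟨∅, Bornology.isBounded_empty, fun x => isEmptyElim x⟩
    obtain ⟨D, -, hD⟩ := h x₀ (max r 1) (by positivity) ε hε
    refine ⟨Metric.ball x₀ D, Metric.isBounded_ball, fun x hx y hxy => ?_⟩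
    rw [Metric.mem_ball, not_lt] at hx
    refine (Metric.dist_le_diam_of_mem (Metric.isBounded_of_compactSpace)
      (Set.mem_image_of_mem φ (Metric.mem_ball_self (by positivity)))
      (Set.mem_image_of_mem φ ?_)).trans_lt (hD x hx)
    rw [Metric.mem_ball']
    exact hxy.trans_le (le_max_left _ _)
  · intro h x₀ r hr ε hε
    -- Two points of an `r`-ball are less than `2 * r` apart; `ε / 2` restores strictness for the
    -- diameter.
    obtain ⟨S, hS, hφ⟩ := h (2 * r) (ε / 2) (by positivity)
    obtain ⟨D, hD⟩ := hS.subset_ball x₀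
    refine ⟨max D 0 + r, by positivity, fun x hx => ?_⟩
    refine (Metric.diam_le_of_forall_dist_le (half_pos hε).le ?_).trans_lt (half_lt_self hε)
    rintro _ ⟨y, hy, rfl⟩ _ ⟨z, hz, rfl⟩
    rw [Metric.mem_ball] at hy hz
    refine (hφ y (fun hyS => ?_) z ?_).le
    · have := Metric.mem_ball.1 (hD hyS)
      linarith [dist_triangle x y x₀, dist_comm x y, le_max_left D 0]
    · linarith [dist_triangle y x z, dist_comm x z]

/-- A Higson function with values `φ x` from a real-valued one. -/
theorem exists_higsonFunction {g : X → ℝ} (hg : Continuous g) (h0 : ∀ x, 0 ≤ g x)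
    (h1 : ∀ x, g x ≤ 1)
    (hs : ∀ r ε : ℝ, 0 < ε → ∃ S : Set X, Bornology.IsBounded S ∧ ∀ x ∉ S, ∀ y, dist x y < r →
        |g x - g y| < ε) :
    ∃ φ : HigsonFunction X, ∀ x, (φ.1 x : ℝ) = g x :=
  ⟨⟨⟨fun x => ⟨g x, h0 x, h1 x⟩, hg.subtype_mk _⟩, slowlyOscillating_iff.2 hs⟩, fun _ => rfl⟩

/-- A relation between the values of a Higson function on `A` extends to the closure of `A`. -/
theorem closure_image_subset_of_forall {A : Set X} {p : HigsonFunction X → unitInterval}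
    (hp : p ∈ closure (higsonMap '' A)) (φ : HigsonFunction X) {s : Set ℝ} (hs : IsClosed s)
    (hA : ∀ x ∈ A, (φ.1 x : ℝ) ∈ s) : (p φ : ℝ) ∈ s := by
  have hc : IsClosed {q : HigsonFunction X → unitInterval | (q φ : ℝ) ∈ s} :=
    hs.preimage (continuous_subtype_val.comp (continuous_apply φ))
  refine closure_minimal ?_ hc hp
  rintro _ ⟨x, hx, rfl⟩
  exact hA x hx

/-- The closure of a bounded set misses the closure of any set at distance at least one. -/
theorem disjoint_closure_of_isBounded {S A : Set X} (hS : Bornology.IsBounded S)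
    (hA : ∀ a ∈ A, ∀ s ∈ S, 1 ≤ dist a s) :
    Disjoint (closure (higsonMap '' S)) (closure (higsonMap '' A)) := by
  rcases S.eq_empty_or_nonempty with rfl | hne
  · simp
  obtain ⟨φ, hφ⟩ := exists_higsonFunction (X := X) (g := fun x => max 0 (1 - Metric.infDist x S))
    (by fun_prop) (fun x => le_max_left _ _)
    (fun x => max_le zero_le_one (by linarith [Metric.infDist_nonneg (x := x) (s := S)])) (by
      intro r ε hε
      refine ⟨Metric.thickening (|r| + 1) S, hS.thickening, fun x hx y hxy => ?_⟩
      have hx' : |r| + 1 ≤ Metric.infDist x S := (Metric.le_infDist hne).2 fun s hs => by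
        by_contra! hlt
        exact hx (Metric.mem_thickening_iff.2 ⟨s, hs, hlt⟩)
      have hy := Metric.infDist_le_infDist_add_dist (s := S) (x := x) (y := y)
      rw [max_eq_left (by linarith [abs_nonneg r]), max_eq_left (by linarith [le_abs_self r])]
      simpa using hε)
  rw [Set.disjoint_left]
  intro p hp hq
  have h1 := closure_image_subset_of_forall hp φ (isClosed_singleton (x := (1 : ℝ))) (by
    intro x hx
    simp [hφ, Metric.infDist_zero_of_mem hx])
  have h0 := closure_image_subset_of_forall hq φ (isClosed_singleton (x := (0 : ℝ))) (by
    intro x hx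
    have : 1 ≤ Metric.infDist x S := (Metric.le_infDist hne).2 fun s hs => hA x hx s hs
    simp [hφ, this])
  rw [Set.mem_singleton_iff] at h0 h1
  linarith

theorem mem_closure_diff_of_mem_higsonCorona {p : HigsonFunction X → unitInterval}
    (hp : p ∈ higsonCorona X) {A S : Set X} (hS : Bornology.IsBounded S)
    (hA : p ∈ closure (higsonMap '' A)) : p ∈ closure (higsonMap '' (A \ S)) := by
  have h : p ∈ closure (higsonMap '' (A \ S)) ∪ closure (higsonMap '' S) := by
    rw [← closure_union, ← Set.image_union]
    exact closure_mono (Set.image_mono (by simp)) hA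
  exact h.resolve_right (hp.2 S hS)

/-- With `u`, `v` the distances to `A` and `B`, the quotient `u / (1 + u + v)` oscillates slowly:
`u` and `v` are 1-Lipschitz and the denominator tends to infinity by asymptotic disjointness. -/
theorem exists_higsonFunction_of_asymptoticallyDisjoint {A B : Set X}
    (h : AsymptoticallyDisjoint A B) (hA : A.Nonempty) (hB : B.Nonempty) :
    ∃ φ : HigsonFunction X, (∀ a ∈ A, (φ.1 a : ℝ) = 0) ∧
      ∃ S : Set X, Bornology.IsBounded S ∧ ∀ b ∈ B \ S, (1 : ℝ) / 2 ≤ φ.1 b := by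
  set u : X → ℝ := fun x => Metric.infDist x A with hu
  set v : X → ℝ := fun x => Metric.infDist x B with hv
  have hu0 : ∀ x, 0 ≤ u x := fun x => Metric.infDist_nonneg
  have hv0 : ∀ x, 0 ≤ v x := fun x => Metric.infDist_nonneg
  have hul : ∀ x y, |u x - u y| ≤ dist x y := fun x y => by
    rw [abs_sub_le_iff]
    have h1 := Metric.infDist_le_infDist_add_dist (s := A) (x := x) (y := y)
    have h2 := Metric.infDist_le_infDist_add_dist (s := A) (x := y) (y := x)
    rw [dist_comm] at h2
    constructor <;> simp only [hu] <;> linarith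
  have hvl : ∀ x y, |v x - v y| ≤ dist x y := fun x y => by
    rw [abs_sub_le_iff]
    have h1 := Metric.infDist_le_infDist_add_dist (s := B) (x := x) (y := y)
    have h2 := Metric.infDist_le_infDist_add_dist (s := B) (x := y) (y := x)
    rw [dist_comm] at h2
    constructor <;> simp only [hv] <;> linarith
  have hbdd : ∀ R, Bornology.IsBounded {x | u x + v x ≤ R} := fun R => by
    refine ((asymptoticallyDisjoint_iff.1 h (R + 2)).cthickening (δ := |R| + 1)).subset ?_
    intro x hx
    obtain ⟨a, ha, hxa⟩ := (Metric.infDist_lt_iff hA).1 (lt_add_one (u x))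
    obtain ⟨b, hb, hxb⟩ := (Metric.infDist_lt_iff hB).1 (lt_add_one (v x))
    have hx' : u x + v x ≤ R := hx
    refine Metric.mem_cthickening_of_dist_le x a _ _ ⟨ha, b, hb, ?_⟩ ?_
    · linarith [dist_triangle a x b, dist_comm a x]
    · linarith [hv0 x, le_abs_self R]
  have hpos : ∀ x, 0 < 1 + u x + v x := fun x => by linarith [hu0 x, hv0 x]
  obtain ⟨φ, hφ⟩ := exists_higsonFunction (X := X) (g := fun x => u x / (1 + u x + v x))
    (by
      refine Continuous.div (Metric.continuous_infDist_pt A) ?_ fun x => (hpos x).ne'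
      exact (continuous_const.add (Metric.continuous_infDist_pt A)).add
        (Metric.continuous_infDist_pt B))
    (fun x => div_nonneg (hu0 x) (hpos x).le)
    (fun x => (div_le_one (hpos x)).2 (by linarith [hv0 x])) (by
      intro r ε hε
      refine ⟨_, hbdd (3 * |r| / ε), fun x hx y hxy => ?_⟩
      have hx' : 3 * |r| / ε < u x + v x := not_le.1 hx
      rw [div_lt_iff₀ hε] at hx'
      -- The numerator is at most `3 * |r|`, which explains the bounded set chosen above.
      have hkey : u x / (1 + u x + v x) - u y / (1 + u y + v y) =
          ((u x - u y) - u y / (1 + u y + v y) * ((u x - u y) + (v x - v y))) /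
            (1 + u x + v x) := by
        have := (hpos x).ne'
        have := (hpos y).ne'
        field_simp
        ring
      have hw0 : 0 ≤ u y / (1 + u y + v y) := div_nonneg (hu0 y) (hpos y).le
      have hw1 : u y / (1 + u y + v y) ≤ 1 := (div_le_one (hpos y)).2 (by linarith [hv0 y])
      rw [hkey, abs_div, abs_of_pos (hpos x), div_lt_iff₀ (hpos x)]
      have h1 : |u x - u y| ≤ |r| := (hul x y).trans (hxy.le.trans (le_abs_self r))
      have h2 : |v x - v y| ≤ |r| := (hvl x y).trans (hxy.le.trans (le_abs_self r))
      have h3 : |u y / (1 + u y + v y) * ((u x - u y) + (v x - v y))| ≤ 1 * (2 * |r|) := by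
        rw [abs_mul, abs_of_nonneg hw0]
        refine mul_le_mul hw1 ((abs_add_le _ _).trans (by linarith)) (abs_nonneg _) zero_le_one
      have h4 := abs_sub (u x - u y) (u y / (1 + u y + v y) * ((u x - u y) + (v x - v y)))
      nlinarith)
  refine ⟨φ, fun a ha => ?_, _, hbdd 1, fun b hb => ?_⟩
  · simp [hφ, hu, Metric.infDist_zero_of_mem ha]
  · have hvb : v b = 0 := Metric.infDist_zero_of_mem hb.1
    have h1 : 1 < u b + v b := not_le.1 hb.2
    rw [hφ, le_div_iff₀ (hpos b)]
    linarith

/-- Two subsets are asymptotically disjoint if and only if their traces are disjoint. -/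
theorem asymptoticallyDisjoint_iff_disjoint_trace {A B : Set X} :
    AsymptoticallyDisjoint A B ↔ Disjoint (trace A) (trace B) := by
  constructor
  · intro h
    rw [Set.disjoint_left]
    intro p hpA hpB
    have hA : A.Nonempty := Set.image_nonempty.1 (closure_nonempty_iff.1 ⟨_, hpA⟩)
    have hB : B.Nonempty := Set.image_nonempty.1 (closure_nonempty_iff.1 ⟨_, hpB⟩)
    obtain ⟨φ, h0, S, hS, h1⟩ := exists_higsonFunction_of_asymptoticallyDisjoint h hA hB
    have hp0 := closure_image_subset_of_forall hpA φ (isClosed_singleton (x := (0 : ℝ))) h0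
    have hp1 := closure_image_subset_of_forall
      (mem_closure_diff_of_mem_higsonCorona p.2 hS hpB) φ (isClosed_Ici (a := (1 / 2 : ℝ))) h1
    rw [Set.mem_singleton_iff] at hp0
    rw [Set.mem_Ici] at hp1
    linarith
  · contrapose!
    rw [asymptoticallyDisjoint_iff]
    push Not
    rintro ⟨R, hR⟩
    set S := {a | a ∈ A ∧ ∃ b ∈ B, dist a b ≤ R} with hSdef
    have hb : ∀ a, ∃ b, a ∈ S → b ∈ B ∧ dist a b ≤ R := fun a => by
      by_cases ha : a ∈ S
      · obtain ⟨b, hb⟩ := ha.2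
        exact ⟨b, fun _ => hb⟩
      · exact ⟨a, fun h => absurd h ha⟩
    choose b hb using hb
    -- An ultrafilter on the unbounded set `S` that escapes to infinity yields a corona point in
    -- both traces.
    have hne : (Bornology.cobounded X ⊓ Filter.principal S).NeBot := by
      rw [Filter.inf_principal_neBot_iff]
      intro U hU
      by_contra hemp
      rw [Set.not_nonempty_iff_eq_empty] at hemp
      refine hR ((Bornology.isBounded_def.2 (Filter.mem_of_superset hU fun x hx hxS => ?_)))
      exact (Set.eq_empty_iff_forall_notMem.1 hemp x) ⟨hx, hxS⟩
    set F := Ultrafilter.of (Bornology.cobounded X ⊓ Filter.principal S) with hF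
    have hFle : (F : Filter X) ≤ Bornology.cobounded X ⊓ Filter.principal S := Ultrafilter.of_le _
    have hFS : ∀ᶠ x in (F : Filter X), x ∈ S :=
      hFle (Filter.mem_inf_of_right (Filter.mem_principal_self S))
    have hFc : ∀ W : Set X, Bornology.IsBounded W → ∀ᶠ x in (F : Filter X), x ∉ W :=
      fun W hW => hFle (Filter.mem_inf_of_left (Bornology.isBounded_def.1 hW))
    obtain ⟨p, -, hp⟩ := isCompact_univ.ultrafilter_le_nhds (F.map (higsonMap (X := X)))
      (by simp)
    have hpt : Filter.Tendsto (higsonMap (X := X)) F (nhds p) := hp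
    have hmem : ∀ W : Set X, (∀ᶠ x in (F : Filter X), x ∈ W) → p ∈ closure (higsonMap '' W) :=
      fun W hW => mem_closure_of_tendsto hpt (hW.mono fun x hx => ⟨x, hx, rfl⟩)
    have hpν : p ∈ higsonCorona X := by
      refine ⟨?_, fun W hW hpW => ?_⟩
      · have := hmem Set.univ (Filter.Eventually.of_forall fun x => trivial)
        rwa [Set.image_univ] at this
      · refine Set.disjoint_left.1 (disjoint_closure_of_isBounded (A := (Metric.thickening 1 W)ᶜ)
          hW ?_) hpW (hmem _ (hFc _ hW.thickening))
        intro a ha s hs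
        by_contra! hlt
        exact ha (Metric.mem_thickening_iff.2 ⟨s, hs, hlt⟩)
    -- Slow oscillation does not see the bounded displacement from `x` to `b x`.
    have hpb : Filter.Tendsto (fun x => higsonMap (b x)) F (nhds p) := by
      rw [tendsto_pi_nhds] at hpt ⊢
      intro φ
      refine (hpt φ).congr_dist ?_
      rw [Metric.tendsto_nhds]
      intro ε hε
      obtain ⟨W, hW, hφ⟩ := slowlyOscillating_iff.1 φ.2 (R + 1) ε hε
      filter_upwards [hFS, hFc W hW] with x hx hxW
      have := hφ x hxW (b x) (by linarith [(hb x hx).2])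
      simpa [higsonMap] using this
    rw [Set.not_disjoint_iff]
    refine ⟨⟨p, hpν⟩, hmem A (hFS.mono fun x hx => hx.1), ?_⟩
    exact mem_closure_of_tendsto hpb (hFS.mono fun x hx => ⟨b x, (hb x hx).1, rfl⟩)

end HigsonCorona

/-! ### Maps of coronas and transfer of separators -/

section Functoriality

variable {X Y : Type u} [MetricSpace X] [MetricSpace Y] {f : Y → X} {K K' : NNReal}

/-- The pullback of a Higson function along a bi-Lipschitz map. -/
def HigsonFunction.comp (hf : LipschitzWith K f) (hf' : AntilipschitzWith K' f)
    (φ : HigsonFunction X) : HigsonFunction Y :=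
  ⟨φ.1.comp ⟨f, hf.continuous⟩, slowlyOscillating_iff.2 fun r ε hε => by
    obtain ⟨S, hS, hφ⟩ := slowlyOscillating_iff.1 φ.2 (K * |r| + 1) ε hε
    refine ⟨f ⁻¹' S, hf'.isBounded_preimage hS, fun x hx y hxy => hφ _ hx _ ?_⟩
    have h1 := hf.dist_le_mul x y
    have h2 : (K : ℝ) * dist x y ≤ K * |r| :=
      mul_le_mul_of_nonneg_left (hxy.le.trans (le_abs_self r)) K.2
    exact (h1.trans h2).trans_lt (lt_add_one _)⟩

/-- The map between the ambient cubes of the Higson compactifications that is induced by a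
bi-Lipschitz map. -/
def cubeMap (hf : LipschitzWith K f) (hf' : AntilipschitzWith K' f)
    (p : HigsonFunction Y → unitInterval) : HigsonFunction X → unitInterval :=
  fun φ => p (φ.comp hf hf')

theorem continuous_cubeMap (hf : LipschitzWith K f) (hf' : AntilipschitzWith K' f) :
    Continuous (cubeMap hf hf') :=
  continuous_pi fun φ => continuous_apply (φ.comp hf hf')

theorem cubeMap_mem_closure (hf : LipschitzWith K f) (hf' : AntilipschitzWith K' f) {A : Set Y}
    {p : HigsonFunction Y → unitInterval} (hp : p ∈ closure (higsonMap '' A)) :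
    cubeMap hf hf' p ∈ closure (higsonMap '' (f '' A)) := by
  refine map_mem_closure (continuous_cubeMap hf hf') hp ?_
  rintro _ ⟨y, hy, rfl⟩
  exact ⟨f y, ⟨y, hy, rfl⟩, rfl⟩

theorem cubeMap_mem_higsonCorona (hf : LipschitzWith K f) (hf' : AntilipschitzWith K' f)
    {p : HigsonFunction Y → unitInterval} (hp : p ∈ higsonCorona Y) :
    cubeMap hf hf' p ∈ higsonCorona X := by
  have hpu : p ∈ closure (higsonMap '' (Set.univ : Set Y)) := by
    rw [Set.image_univ]
    exact hp.1
  refine ⟨closure_mono (Set.image_subset_range _ _) (cubeMap_mem_closure hf hf' hpu),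
    fun S hS hpS => ?_⟩
  have h := cubeMap_mem_closure hf hf' (mem_closure_diff_of_mem_higsonCorona hp
    (hf'.isBounded_preimage (hS.thickening (δ := 1))) hpu)
  refine Set.disjoint_left.1 (disjoint_closure_of_isBounded hS ?_) hpS h
  rintro _ ⟨y, hy, rfl⟩ s hs
  by_contra! hlt
  exact hy.2 (Metric.mem_thickening_iff.2 ⟨s, hs, hlt⟩)

/-- The map of Higson coronas induced by a bi-Lipschitz map. -/
def coronaMap (hf : LipschitzWith K f) (hf' : AntilipschitzWith K' f) (p : higsonCorona Y) :
    higsonCorona X :=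
  ⟨cubeMap hf hf' p.1, cubeMap_mem_higsonCorona hf hf' p.2⟩

theorem continuous_coronaMap (hf : LipschitzWith K f) (hf' : AntilipschitzWith K' f) :
    Continuous (coronaMap hf hf') :=
  ((continuous_cubeMap hf hf').comp continuous_subtype_val).subtype_mk _

theorem coronaMap_mem_trace (hf : LipschitzWith K f) (hf' : AntilipschitzWith K' f) {A : Set Y}
    {p : higsonCorona Y} (hp : p ∈ trace A) : coronaMap hf hf' p ∈ trace (f '' A) :=
  cubeMap_mem_closure hf hf' hp

theorem isClosed_trace (A : Set X) : IsClosed (trace A) :=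
  isClosed_closure.preimage continuous_subtype_val

/-- A point of the corona outside the trace of `T` lies in the trace of a set that is
asymptotically disjoint from `T`. -/
theorem exists_mem_trace_of_notMem_trace {T : Set X} {p : higsonCorona X} (hp : p ∉ trace T) :
    ∃ Z : Set X, p ∈ trace Z ∧ AsymptoticallyDisjoint Z T := by
  obtain ⟨N, hN, hNc, hNT⟩ := exists_mem_nhds_isClosed_subset (isClosed_closure.compl_mem_nhds hp)
  refine ⟨higsonMap ⁻¹' N, ?_, asymptoticallyDisjoint_iff_disjoint_trace.2 ?_⟩
  · refine mem_closure_iff_nhds.2 fun W hW => ?_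
    obtain ⟨_, hx, x, rfl⟩ := mem_closure_iff_nhds.1 p.2.1 _ (Filter.inter_mem hW hN)
    exact ⟨_, hx.1, x, hx.2, rfl⟩
  · exact Set.disjoint_left.2 fun q hq =>
      hNT (closure_minimal (Set.image_preimage_subset _ _) hNc hq)

theorem AsymptoticallyDisjoint.image (hf : LipschitzWith K f) (hf' : AntilipschitzWith K' f)
    {A B : Set Y} (h : AsymptoticallyDisjoint A B) : AsymptoticallyDisjoint (f '' A) (f '' B) := by
  rw [asymptoticallyDisjoint_iff] at h ⊢
  intro R
  refine (hf.isBounded_image (h (K' * R))).subset ?_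
  rintro _ ⟨⟨a, ha, rfl⟩, _, ⟨b, hb, rfl⟩, hab⟩
  exact ⟨a, ⟨ha, b, hb, (hf'.le_mul_dist a b).trans (mul_le_mul_of_nonneg_left hab K'.2)⟩, rfl⟩

/-- A subset `T` of `Y` is an asymptotic separator if it is asymptotically disjoint from the two
given sets and asymptotically contains everything close to a separator in a larger space. -/
theorem isAsymptoticSeparator_of_image (hf : LipschitzWith K f) (hf' : AntilipschitzWith K' f)
    {A B T : Set Y} {C : Set X} (hC : IsAsymptoticSeparator C (f '' A) (f '' B))
    (hT : IsClosed T) (hAT : AsymptoticallyDisjoint A T) (hBT : AsymptoticallyDisjoint B T)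
    (hCT : ∀ Z : Set Y, AsymptoticallyDisjoint Z T → AsymptoticallyDisjoint (f '' Z) C) :
    IsAsymptoticSeparator T A B := by
  obtain ⟨-, U, V, hU, hV, hUV, hCUV, hA, hB⟩ := hC
  refine ⟨hT, coronaMap hf hf' ⁻¹' U \ trace T, coronaMap hf hf' ⁻¹' V \ trace T,
    (hU.preimage (continuous_coronaMap hf hf')).sdiff (isClosed_trace T),
    (hV.preimage (continuous_coronaMap hf hf')).sdiff (isClosed_trace T),
    (hUV.preimage _).mono Set.sdiff_subset Set.sdiff_subset, ?_, ?_, ?_⟩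
  · rw [← Set.union_sdiff_distrib, ← Set.preimage_union, ← hCUV]
    -- It remains to see that the preimage of the trace of `C` lies in the trace of `T`.
    refine Set.Subset.antisymm (fun p hp => ⟨fun hpC => ?_, hp⟩) fun p hp => hp.2
    obtain ⟨Z, hpZ, hZ⟩ := exists_mem_trace_of_notMem_trace hp
    exact Set.disjoint_left.1 (asymptoticallyDisjoint_iff_disjoint_trace.1 (hCT Z hZ))
      (coronaMap_mem_trace hf hf' hpZ) hpC
  · exact fun p hp => ⟨hA (coronaMap_mem_trace hf hf' hp),
      Set.disjoint_left.1 (asymptoticallyDisjoint_iff_disjoint_trace.1 hAT) hp⟩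
  · exact fun p hp => ⟨hB (coronaMap_mem_trace hf hf' hp),
      Set.disjoint_left.1 (asymptoticallyDisjoint_iff_disjoint_trace.1 hBT) hp⟩

end Functoriality

/-! ### The thinned separator and the induction -/

/-- `T ⊆ Y` is obtained by thinning out the set of points of `Y` that are close to the separator `C`
of the images of `A` and `B`, the more so the further they are from `C`. It then embeds into `C`. -/
theorem exists_isAsymptoticSeparator_of_image {X Y : Type u} [MetricSpace X] [MetricSpace Y]
    {f : Y → X} {K K' : NNReal} (hf : LipschitzWith K f) (hf' : AntilipschitzWith K' f)
    {A B : Set Y} {C : Set X} (hC : IsAsymptoticSeparator C (f '' A) (f '' B)) :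
    ∃ T : Set Y, IsAsymptoticSeparator T A B ∧ ∃ (g : T → C) (L L' : NNReal),
      LipschitzWith L g ∧ AntilipschitzWith L' g := by
  classical
  have hdisj : AsymptoticallyDisjoint (f '' (A ∪ B)) C := by
    have hp := hC.2
    obtain ⟨U, V, -, -, -, hCUV, hA, hB⟩ := hp
    have hAC : AsymptoticallyDisjoint (f '' A) C :=
      asymptoticallyDisjoint_iff_disjoint_trace.2
        (Set.disjoint_left.2 fun p hp => hCUV.ge (Or.inl (hA hp)))
    have hBC : AsymptoticallyDisjoint (f '' B) C :=
      asymptoticallyDisjoint_iff_disjoint_trace.2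
        (Set.disjoint_left.2 fun p hp => hCUV.ge (Or.inr (hB hp)))
    rw [asymptoticallyDisjoint_iff] at hAC hBC ⊢
    refine fun R => ((hAC R).union (hBC R)).subset ?_
    rintro x ⟨hx, hb⟩
    rw [Set.image_union] at hx
    exact hx.imp (fun h => ⟨h, hb⟩) fun h => ⟨h, hb⟩
  -- The factor 2 keeps these points closer to `C` than to `A ∪ B`, so a net point near `A ∪ B`
  -- forces `C` to be near there too.
  let E : ℕ → Set Y := fun k =>
    {y | ∃ c ∈ C, dist (f y) c ≤ k ∧ ∀ a ∈ A ∪ B, 2 * dist (f y) c ≤ dist (f y) (f a)}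
  -- The default value 0 outside the union of the `E k` is harmless: only levels of points in the
  -- union matter.
  let ℓ : Y → ℕ := fun y => sInf {k | y ∈ E k}
  have hℓ : ∀ {y k}, y ∈ E k → y ∈ E (ℓ y) := fun {y k} h =>
    Nat.sInf_mem (s := {k | y ∈ E k}) ⟨k, h⟩
  have hℓle : ∀ {y k}, y ∈ E k → ℓ y ≤ k := fun {y k} h => Nat.sInf_le h
  obtain ⟨T, hTE, hTsep, hTnet⟩ := exists_sparse_net (fun x y => dist (f x) (f y))
    (fun x y => dist_comm _ _) ℓ (fun k => 4 * ((k : ℝ) + 1)) (⋃ k, E k)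
  have hTE' : ∀ t ∈ T, t ∈ E (ℓ t) := fun t ht => by
    obtain ⟨k, hk⟩ := Set.mem_iUnion.1 (hTE ht)
    exact hℓ hk
  have hABT : AsymptoticallyDisjoint (A ∪ B) T := by
    rw [asymptoticallyDisjoint_iff] at hdisj ⊢
    refine fun R => (hf'.isBounded_preimage (hdisj (2 * (K * R)))).subset ?_
    rintro a ⟨ha, t, ht, hat⟩
    obtain ⟨c, hc, -, hct⟩ := hTE' t ht
    refine ⟨⟨a, ha, rfl⟩, c, hc, ?_⟩
    have h1 := hct a ha
    have h2 := (hf.dist_le_mul a t).trans (mul_le_mul_of_nonneg_left hat K.2)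
    have h3 := dist_triangle (f a) (f t) c
    rw [dist_comm (f t) (f a)] at h1
    change dist (f a) (f t) ≤ K * R at h2
    linarith [dist_nonneg (x := f a) (y := f t)]
  have hmono : ∀ {D : Set Y}, D ⊆ A ∪ B → AsymptoticallyDisjoint D T := fun hD => by
    rw [asymptoticallyDisjoint_iff] at hABT ⊢
    exact fun R => (hABT R).subset fun a ha => ⟨hD ha.1, ha.2⟩
  -- The `+ 1` in the spacing makes `T` uniformly discrete, even at level 0.
  have hTclosed : IsClosed T := by
    refine Metric.isClosed_of_pairwise_le_dist (ε := 4 / (K + 1)) (by positivity) ?_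
    intro x hx y hy hxy
    have h1 := hTsep x hx y hy hxy
    have h2 := hf.dist_le_mul x y
    rw [div_le_iff₀ (by positivity)]
    have h3 : (0 : ℝ) ≤ (max (ℓ x) (ℓ y) : ℕ) := Nat.cast_nonneg _
    linarith [dist_nonneg (x := x) (y := y)]
  refine ⟨T, isAsymptoticSeparator_of_image hf hf' hC hTclosed (hmono Set.subset_union_left)
    (hmono Set.subset_union_right) ?_, ?_⟩
  · intro Z hZ
    rw [asymptoticallyDisjoint_iff] at hZ hdisj ⊢
    intro R
    obtain ⟨k, hk⟩ := exists_nat_ge R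
    refine ((hf.isBounded_image (hZ (K' * (4 * ((k : ℝ) + 1))))).union
      ((hdisj (3 * R)).thickening (δ := 2 * |R| + 1))).subset ?_
    rintro _ ⟨⟨z, hz, rfl⟩, c, hc, hzc⟩
    -- Either `z` has level at most `k` and so a net point within `4 * (k + 1)`, or `f z` is near a
    -- point of `f '' (A ∪ B)` that is itself within `3 * R` of `C`; such points form a bounded set.
    by_cases hzE : ∀ a ∈ A ∪ B, 2 * dist (f z) c ≤ dist (f z) (f a)
    · have hzk : z ∈ E k := ⟨c, hc, hzc.trans hk, hzE⟩
      obtain ⟨t, ht, h⟩ := hTnet z (Set.mem_iUnion.2 ⟨k, hzk⟩)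
      refine Or.inl ⟨z, ⟨hz, t, ht, (hf'.le_mul_dist z t).trans
        (mul_le_mul_of_nonneg_left ?_ K'.2)⟩, rfl⟩
      rcases h with rfl | h
      · rw [dist_self]
        positivity
      · have : (ℓ z : ℝ) ≤ k := Nat.cast_le.2 (hℓle hzk)
        linarith
    · push Not at hzE
      obtain ⟨a, ha, hlt⟩ := hzE
      refine Or.inr (Metric.mem_thickening_iff.2 ⟨f a, ⟨⟨a, ha, rfl⟩, c, hc, ?_⟩, ?_⟩)
      · linarith [dist_triangle (f a) (f z) c, dist_comm (f a) (f z)]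
      · linarith [le_abs_self R]
  · choose g hgC hgd using fun t : T => hTE' t t.2
    -- Each displacement is at most the larger level, while the spacing is at least four times that;
    -- hence the constants `2 * K` and `2 * K'`.
    have hclose : ∀ s t : T, s ≠ t → dist (f s) (g s) + dist (f t) (g t) ≤ dist (f s) (f t) / 2 := by
      intro s t hst
      have h1 := hTsep s s.2 t t.2 (Subtype.coe_injective.ne hst)
      have h2 : (ℓ s : ℝ) ≤ (max (ℓ s) (ℓ t) : ℕ) := Nat.cast_le.2 (le_max_left _ _)
      have h3 : (ℓ t : ℝ) ≤ (max (ℓ s) (ℓ t) : ℕ) := Nat.cast_le.2 (le_max_right _ _)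
      linarith [(hgd s).1, (hgd t).1]
    refine ⟨fun t => ⟨g t, hgC t⟩, 2 * K, 2 * K', LipschitzWith.of_dist_le_mul fun s t => ?_,
      AntilipschitzWith.of_le_mul_dist fun s t => ?_⟩
    · rcases eq_or_ne s t with rfl | hst
      · simp
      have h1 := hclose s t hst
      have h2 := hf.dist_le_mul s t
      have h3 := dist_triangle4 (g s) (f s) (f t) (g t)
      rw [dist_comm (g s) (f s)] at h3
      simp only [Subtype.dist_eq, NNReal.coe_mul, NNReal.coe_ofNat] at *
      linarith [dist_nonneg (x := f s) (y := f t)]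
    · rcases eq_or_ne s t with rfl | hst
      · simp
      have h1 := hclose s t hst
      have h2 := hf'.le_mul_dist s t
      have h3 := dist_triangle4 (f s) (g s) (g t) (f t)
      rw [dist_comm (g t) (f t)] at h3
      have h4 : dist (f s) (f t) ≤ 2 * dist (g s) (g t) := by linarith
      have h5 := mul_le_mul_of_nonneg_left h4 K'.2
      simp only [Subtype.dist_eq, NNReal.coe_mul, NNReal.coe_ofNat]
      change (K' : ℝ) * _ ≤ K' * _ at h5
      linarith

/-- The asymptotic large inductive dimension does not grow under passage to a space with a
bi-Lipschitz embedding into the given one. -/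
theorem AsIndLT.of_biLipschitz : ∀ (n : ℕ) {X Y : Type u} [MetricSpace X] [MetricSpace Y]
    {f : Y → X} {K K' : NNReal}, LipschitzWith K f → AntilipschitzWith K' f →
    AsIndLT n X → AsIndLT n Y
  | 0, _, _, _, _, _, _, _, _, hf', h => hf'.isBounded_preimage h
  | n + 1, _, _, _, _, _, _, _, hf, hf', h => fun A B hAB => by
    obtain ⟨C, hC, hn⟩ := h _ _ (hAB.image hf hf')
    obtain ⟨T, hT, g, L, L', hg, hg'⟩ := exists_isAsymptoticSeparator_of_image hf hf' hC
    exact ⟨T, hT, AsIndLT.of_biLipschitz n hg hg' hn⟩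

end AsymptoticDimension

theorem theorem2 {X : Type*} [MetricSpace X] [ProperSpace X] (Y : Set X) :
    AsymptoticDimension.asInd Y ≤ AsymptoticDimension.asInd X := by
  classical
  by_cases h : ∃ n : ℕ, AsymptoticDimension.AsIndLT n X
  · rw [AsymptoticDimension.asInd, AsymptoticDimension.asInd.eq_def X, dif_pos h]
    exact (AsymptoticDimension.asInd_le_iff Y _).2
      (AsymptoticDimension.AsIndLT.of_biLipschitz _ (LipschitzWith.subtype_val Y)
        isometry_subtype_coe.antilipschitz (Nat.find_spec h))
  · rw [AsymptoticDimension.asInd.eq_def X, dif_neg h]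
    exact le_top
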